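/- For $x>0$ and $0\le k\le 1$ let $Ie(k,x)=\int_0^x e^{-t}I_0(kt)\,dt$ be the Rice $Ie$-function, where $I_0(z)=\sum_{l\ge 0}\frac{(z/2)^{2l}}{(l!)^2}$ is the modified Bessel function of the first kind of order zero, and let $Q(y)=\frac{1}{\sqrt{2\pi}}\int_y^\infty e^{-t^2/2}\,dt$ be the Gaussian $Q$-function. For $0\le k<1$ put $$U(k,x)=1+\frac{\sqrt{k}}{\sqrt{2(1-k)}}+\frac{\sqrt{2k}\,Q(\sqrt{2x}\sqrt{1+k})}{\sqrt{1+k}}-\frac{I_0(kx)}{e^{x}}-\frac{\sqrt{k}}{\sqrt{2(1+k)}}-\frac{\sqrt{2k}\,Q(\sqrt{2x}\sqrt{1-k})}{\sqrt{1-k}},$$ $$L(k,x)=\frac{2Q(b+a)+2Q(b-a)-e^{-x}I_0(kx)-1}{\sqrt{1-k^2}},\qquad a=\sqrt{x}\sqrt{1+\sqrt{1-k^2}},\quad b=\sqrt{x}\sqrt{1-\sqrt{1-k^2}}.$$ Then, for every $x>0$: 1. $L(k,x)<Ie(k,x)<U(k,x)$ for all $0<k<1$. 2. For $k=0$ both bounds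 are attained: $L(0,x)=Ie(0,x)=U(0,x)$. 3. For $k=1$ the bounds hold when they are read as limits for $k\to1^-$: $L(k,x)\to-\infty$, and $U(k,x)\to\frac12+\sqrt{\frac{2x}{\pi}}+Q(2\sqrt{x})-I_0(x)e^{-x}$, with $Ie(1,x)<\frac12+\sqrt{\frac{2x}{\pi}}+Q(2\sqrt{x})-I_0(x)e^{-x}$. -/

import Mathlib

open Filter Topology

noncomputable section

/-- The modified Bessel function of the first kind of integer order `n`,
`I_n(x) = ∑ₗ (x/2)^(2l+n) / (l! (l+n)!)`. -/
def besselI (n : ℕ) (x : ℝ) : ℝ :=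
  ∑' l : ℕ, (x / 2) ^ (2 * l + n) / ((l.factorial : ℝ) * ((l + n).factorial : ℝ))

/-- The series defining `besselI` converges for every order and every argument. -/
theorem summable_besselI (n : ℕ) (x : ℝ) :
    Summable fun l : ℕ =>
      (x / 2) ^ (2 * l + n) / ((l.factorial : ℝ) * ((l + n).factorial : ℝ)) := by
  have h : Summable fun l : ℕ => |x / 2| ^ n * (((x / 2) ^ 2) ^ l / (l.factorial : ℝ)) :=
    (Real.summable_pow_div_factorial ((x / 2) ^ 2)).mul_left _
  refine Summable.of_norm_bounded h fun l => ?_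
  have h1 : (1 : ℝ) ≤ ((l + n).factorial : ℝ) := by
    exact_mod_cast (l + n).factorial_pos
  have h2 : (0 : ℝ) < (l.factorial : ℝ) := by exact_mod_cast l.factorial_pos
  have h3 : ‖(x / 2) ^ (2 * l + n) / ((l.factorial : ℝ) * ((l + n).factorial : ℝ))‖ =
      (|x / 2| ^ n * ((x / 2) ^ 2) ^ l) / ((l.factorial : ℝ) * ((l + n).factorial : ℝ)) := by
    rw [Real.norm_eq_abs, abs_div, abs_pow, pow_add, pow_mul, sq_abs, mul_comm (|x / 2| ^ n),
      abs_of_pos (mul_pos h2 (lt_of_lt_of_le one_pos h1))]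
  rw [h3, ← mul_div_assoc]
  gcongr
  exact le_mul_of_one_le_right h2.le h1

/-- The Gaussian `Q`-function `Q(x) = (2π)^(-1/2) ∫_x^∞ e^(-t²/2) dt`. -/
def gaussianQ (x : ℝ) : ℝ :=
  1 / √(2 * Real.pi) * ∫ t in Set.Ioi x, Real.exp (-t ^ 2 / 2)

/-- The Rice function `Ie(k,x) = ∫_0^x e^(-t) I_0(kt) dt`. -/
def riceIe (k x : ℝ) : ℝ :=
  ∫ t in (0 : ℝ)..x, Real.exp (-t) * besselI 0 (k * t)

/-- The upper bound for `Ie(k,x)`; the formula is meaningful for `0 ≤ k < 1`. -/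
def riceUpper (k x : ℝ) : ℝ :=
  1 + √k / √(2 * (1 - k)) + √(2 * k) * gaussianQ (√(2 * x) * √(1 + k)) / √(1 + k)
    - besselI 0 (k * x) / Real.exp x - √k / √(2 * (1 + k))
    - √(2 * k) * gaussianQ (√(2 * x) * √(1 - k)) / √(1 - k)

/-- The parameter `a = √x √(1 + √(1 - k²))` of the lower bound. -/
def riceA (k x : ℝ) : ℝ := √x * √(1 + √(1 - k ^ 2))

/-- The parameter `b = √x √(1 - √(1 - k²))` of the lower bound. -/
def riceB (k x : ℝ) : ℝ := √x * √(1 - √(1 - k ^ 2))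

/-- The lower bound for `Ie(k,x)`; the formula is meaningful for `0 ≤ k < 1`. -/
def riceLower (k x : ℝ) : ℝ :=
  (2 * gaussianQ (riceB k x + riceA k x) + 2 * gaussianQ (riceB k x - riceA k x)
    - Real.exp (-x) * besselI 0 (k * x) - 1) / √(1 - k ^ 2)

end

/-! Upper bound: `U - Ie` vanishes at `x = 0` and has `x`-derivative `e^(-x) (√(2k/(πx)) sinh(kx) -
k I_1(kx))`. This is positive because `I_1(z) < √(2/(πz)) sinh z` (`besselI_one_lt_sinh`): in `π
I_1(z) = ∫_0^π sinh(z sin θ) sin θ dθ` the factor `sinh(z sin θ)` is at most `sinh z · e^(-z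
cos²θ/2)`, and `u = cos θ` leaves a truncated Gaussian integral. The same comparison works at `k =
1`.

Lower bound: with `s = √(1-k²)` one has `a² + b² = 2x`, `ab = kx` and `b² = x(1-s)`. Let `P` be the
planar Gaussian probability of a disk of radius `b` centred at distance `a` from the origin. Then
`2P = 1 - e^(-x) I_0(kx) - s Ie(k,x)` (`two_mul_gaussianDisk`). The disk lies in a strip of
probability `Q(a-b) - Q(a+b)`, and `P < Q(a-b) - Q(a+b)` rearranges to `L < Ie`. This inequality is
proved by one-variable calculus in `gaussianDisk_lt_strip`. -/

/-! ### Power series and derivatives of `I_0` and `I_1`. -/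

/-- The entire function `∑ₗ w^l / (l! (l+n)!)`, which satisfies `I_n(z) = (z/2)^n c_n(z²/4)`. -/
noncomputable def besselC (n : ℕ) (w : ℝ) : ℝ :=
  ∑' l : ℕ, w ^ l / ((l.factorial : ℝ) * ((l + n).factorial : ℝ))

theorem summable_besselC (n : ℕ) (w : ℝ) :
    Summable fun l : ℕ => w ^ l / ((l.factorial : ℝ) * ((l + n).factorial : ℝ)) := by
  refine Summable.of_norm_bounded (Real.summable_pow_div_factorial |w|) fun l => ?_
  have h1 : (1 : ℝ) ≤ ((l + n).factorial : ℝ) := by exact_mod_cast (l + n).factorial_pos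
  have h2 : (0 : ℝ) < (l.factorial : ℝ) := by exact_mod_cast l.factorial_pos
  rw [Real.norm_eq_abs, abs_div, abs_pow, abs_of_pos (mul_pos h2 (lt_of_lt_of_le one_pos h1))]
  gcongr
  exact le_mul_of_one_le_right h2.le h1

theorem besselI_eq (n : ℕ) (z : ℝ) : besselI n z = (z / 2) ^ n * besselC n ((z / 2) ^ 2) := by
  rw [besselI, besselC, ← tsum_mul_left]
  refine tsum_congr fun l => ?_
  rw [pow_add, pow_mul]
  ring

theorem besselC_deriv_term (n l : ℕ) (w : ℝ) :
    ((l + 1 : ℕ) : ℝ) * w ^ (l + 1 - 1) / (((l + 1).factorial : ℝ) * ((l + 1 + n).factorial : ℝ))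
      = w ^ l / ((l.factorial : ℝ) * ((l + (n + 1)).factorial : ℝ)) := by
  have h2 : (l.factorial : ℝ) ≠ 0 := by exact_mod_cast l.factorial_ne_zero
  rw [show l + 1 + n = l + (n + 1) by ring, Nat.factorial_succ l, Nat.add_sub_cancel]
  have h3 : ((l + (n + 1)).factorial : ℝ) ≠ 0 := by exact_mod_cast Nat.factorial_ne_zero _
  push_cast
  field_simp

theorem hasDerivAt_besselC (n : ℕ) (w : ℝ) :
    HasDerivAt (besselC n) (besselC (n + 1) w) w := by
  set g' : ℕ → ℝ → ℝ := fun l y =>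
    (l : ℝ) * y ^ (l - 1) / ((l.factorial : ℝ) * ((l + n).factorial : ℝ)) with hg'
  have hs : ∀ y, Summable fun l => g' l y := fun y => by
    rw [← summable_nat_add_iff 1]
    refine (summable_besselC (n + 1) y).congr fun l => ?_
    simp only [hg']
    rw [besselC_deriv_term]
  -- The coefficients are nonnegative, so on the ball each differentiated term is dominated by its
  -- value at the radius `|w| + 1`.
  have key := hasDerivAt_tsum_of_isPreconnected (𝕜 := ℝ) (u := fun l => g' l (|w| + 1))
    (g := fun (l : ℕ) (y : ℝ) => y ^ l / ((l.factorial : ℝ) * ((l + n).factorial : ℝ)))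
    (g' := g') (t := Metric.ball 0 (|w| + 1)) (y₀ := 0) (y := w) (hs _) Metric.isOpen_ball
    (convex_ball _ _).isPreconnected
    (fun l y _ => (hasDerivAt_pow l y).div_const _)
    (fun l y hy => by
      have hy' : |y| ≤ |w| + 1 := by simpa using (Metric.mem_ball.1 hy).le
      simp only [hg', Real.norm_eq_abs]
      rw [abs_div, abs_mul, abs_pow, abs_of_nonneg (Nat.cast_nonneg l),
        abs_of_nonneg (by positivity : (0 : ℝ) ≤ (l.factorial : ℝ) * ((l + n).factorial : ℝ))]
      gcongr)
    (by simp; positivity) (summable_besselC n 0) (by simp)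
  have e : ∑' l, g' l w = besselC (n + 1) w := by
    rw [(hs w).tsum_eq_zero_add, besselC]
    simp only [hg', Nat.cast_zero, zero_mul, zero_div, zero_add]
    exact tsum_congr fun l => besselC_deriv_term n l w
  rw [← e]
  exact key

theorem continuous_besselC (n : ℕ) : Continuous (besselC n) :=
  continuous_iff_continuousAt.2 fun w => (hasDerivAt_besselC n w).continuousAt

/-- This is the recurrence `I_0(z) = I_2(z) + (2/z) I_1(z)` freed of division by `z`. It holds
coefficientwise. -/
theorem besselC_zero_eq (w : ℝ) : besselC 0 w = w * besselC 2 w + besselC 1 w := by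
  have hs := (summable_besselC 2 w).mul_left w
  have h1 := summable_besselC 1 w
  have h1' := (summable_nat_add_iff 1).2 h1
  rw [besselC, (summable_besselC 0 w).tsum_eq_zero_add, besselC, besselC, ← tsum_mul_left,
    h1.tsum_eq_zero_add]
  rw [add_left_comm, ← hs.tsum_add h1']
  congr 1
  refine tsum_congr fun l => ?_
  have h2 : (l.factorial : ℝ) ≠ 0 := by exact_mod_cast l.factorial_ne_zero
  rw [show l + 1 + 0 = l + 1 from rfl, show l + 1 + 1 = l + 2 from rfl, Nat.factorial_succ (l + 1),
    Nat.factorial_succ l]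
  have h3 : (l : ℝ) + 1 ≠ 0 := by positivity
  have h4 : (l : ℝ) + 1 + 1 ≠ 0 := by positivity
  push_cast
  field_simp
  ring

theorem besselI_zero_eq (z : ℝ) : besselI 0 z = besselC 0 ((z / 2) ^ 2) := by
  simp [besselI_eq]

theorem besselI_one_eq (z : ℝ) : besselI 1 z = z / 2 * besselC 1 ((z / 2) ^ 2) := by
  simp [besselI_eq]

theorem continuous_besselI (n : ℕ) : Continuous (besselI n) := by
  rw [show besselI n = fun z => (z / 2) ^ n * besselC n ((z / 2) ^ 2) from funext (besselI_eq n)]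
  have := continuous_besselC n
  fun_prop

theorem hasDerivAt_besselI_zero (z : ℝ) : HasDerivAt (besselI 0) (besselI 1 z) z := by
  rw [show besselI 0 = fun z => besselC 0 ((z / 2) ^ 2) from funext besselI_zero_eq]
  have h : HasDerivAt (fun z : ℝ => (z / 2) ^ 2) (z / 2) z := by
    refine (((hasDerivAt_id z).div_const 2).pow 2).congr_deriv ?_
    simp; ring
  refine ((hasDerivAt_besselC 0 _).comp z h).congr_deriv ?_
  rw [besselI_one_eq]
  ring

/-- The term `besselC 1 ((z / 2) ^ 2) / 2` stands for `I_1(z)/z`, so that `z = 0` is included. -/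
theorem hasDerivAt_besselI_one (z : ℝ) :
    HasDerivAt (besselI 1) (besselI 0 z - besselC 1 ((z / 2) ^ 2) / 2) z := by
  rw [show besselI 1 = fun z => z / 2 * besselC 1 ((z / 2) ^ 2) from funext besselI_one_eq]
  have h : HasDerivAt (fun z : ℝ => (z / 2) ^ 2) (z / 2) z := by
    refine (((hasDerivAt_id z).div_const 2).pow 2).congr_deriv ?_
    simp; ring
  refine (((hasDerivAt_id z).div_const 2).mul ((hasDerivAt_besselC 1 _).comp z h)).congr_deriv ?_
  rw [besselI_zero_eq, besselC_zero_eq]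
  simp only [Function.comp, id]
  ring

theorem besselI_zero_zero : besselI 0 0 = 1 := by
  rw [besselI, tsum_eq_single 0]
  · simp
  · intro l hl
    simp [hl]

theorem one_le_besselI_zero (z : ℝ) : 1 ≤ besselI 0 z := by
  have h := (summable_besselI 0 z).sum_le_tsum {0} (fun l _ => by
    rw [add_zero, pow_mul]; positivity)
  simpa [besselI] using h

theorem besselI_one_pos {z : ℝ} (hz : 0 < z) : 0 < besselI 1 z := by
  rw [besselI]
  exact (summable_besselI 1 z).tsum_pos (fun l => by positivity) 0 (by positivity)

/-! ### Integral representation of `I_1`. -/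

/-- Puts the Wallis product from `∫_0^π sin^(2l+2)` into the factorials of the series of `I_1`. -/
theorem prod_odd_div_even (l : ℕ) :
    (∏ i ∈ Finset.range (l + 1), (2 * (i : ℝ) + 1) / (2 * i + 2)) =
      ((2 * l + 1).factorial : ℝ) / (2 ^ (2 * l + 1) * l.factorial * (l + 1).factorial) := by
  induction l with
  | zero => simp
  | succ l ih =>
    have h2 : (l.factorial : ℝ) ≠ 0 := by exact_mod_cast l.factorial_ne_zero
    have h3 : ((2 * l + 1).factorial : ℝ) ≠ 0 := by exact_mod_cast Nat.factorial_ne_zero _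
    rw [Finset.prod_range_succ, ih, show 2 * (l + 1) + 1 = 2 * l + 1 + 1 + 1 by ring,
      Nat.factorial_succ (2 * l + 1 + 1), Nat.factorial_succ (2 * l + 1),
      Nat.factorial_succ (l + 1), Nat.factorial_succ l]
    push_cast
    have h4 : (l : ℝ) + 1 ≠ 0 := by positivity
    have h5 : (l : ℝ) + 1 + 1 ≠ 0 := by positivity
    field_simp
    ring

/-- The integral representation `I_1(z) = π⁻¹ ∫_0^π sinh(z sin θ) sin θ dθ`. -/
theorem besselI_one_eq_integral (z : ℝ) :
    Real.pi * besselI 1 z =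
      ∫ θ in (0 : ℝ)..Real.pi, Real.sinh (z * Real.sin θ) * Real.sin θ := by
  have hb : Summable fun l : ℕ => |z| ^ (2 * l + 1) / ((2 * l + 1).factorial : ℝ) :=
    (Real.summable_pow_div_factorial |z|).comp_injective
      (i := fun l : ℕ => 2 * l + 1) (fun a b h => by simpa using h)
  have key := intervalIntegral.hasSum_integral_of_dominated_convergence
    (μ := MeasureTheory.volume) (a := 0) (b := Real.pi)
    (F := fun (l : ℕ) (θ : ℝ) =>
      (z * Real.sin θ) ^ (2 * l + 1) / ((2 * l + 1).factorial : ℝ) * Real.sin θ)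
    (f := fun θ => Real.sinh (z * Real.sin θ) * Real.sin θ)
    (fun l _ => |z| ^ (2 * l + 1) / ((2 * l + 1).factorial : ℝ))
    (fun l => Continuous.aestronglyMeasurable (by fun_prop))
    (fun l => Eventually.of_forall fun θ _ => by
      rw [Real.norm_eq_abs, abs_mul, abs_div, abs_pow, abs_mul, mul_pow, Nat.abs_cast]
      have h1 := Real.abs_sin_le_one θ
      have h2 : |Real.sin θ| ^ (2 * l + 1) ≤ 1 := pow_le_one₀ (abs_nonneg _) h1
      have h3 : |z| ^ (2 * l + 1) * |Real.sin θ| ^ (2 * l + 1) ≤ |z| ^ (2 * l + 1) :=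
        mul_le_of_le_one_right (by positivity) h2
      calc _ ≤ |z| ^ (2 * l + 1) * |Real.sin θ| ^ (2 * l + 1) / ((2 * l + 1).factorial : ℝ) :=
            mul_le_of_le_one_right (by positivity) h1
        _ ≤ _ := by gcongr)
    (Eventually.of_forall fun θ _ => hb)
    (by simp)
    (Eventually.of_forall fun θ _ => (Real.hasSum_sinh _).mul_right _)
  rw [← key.tsum_eq, besselI, ← tsum_mul_left]
  refine tsum_congr fun l => ?_
  have e : ∀ θ : ℝ, (z * Real.sin θ) ^ (2 * l + 1) / ((2 * l + 1).factorial : ℝ) * Real.sin θ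
      = z ^ (2 * l + 1) / ((2 * l + 1).factorial : ℝ) * Real.sin θ ^ (2 * (l + 1)) := fun θ => by
    ring
  simp_rw [e]
  rw [intervalIntegral.integral_const_mul, integral_sin_pow_even]
  rw [prod_odd_div_even]
  have h2 : (l.factorial : ℝ) ≠ 0 := by exact_mod_cast l.factorial_ne_zero
  have h3 : ((2 * l + 1).factorial : ℝ) ≠ 0 := by exact_mod_cast Nat.factorial_ne_zero _
  have h4 : ((l + 1).factorial : ℝ) ≠ 0 := by exact_mod_cast Nat.factorial_ne_zero _
  rw [div_pow]
  field_simp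

/-! ### The Gaussian `Q`-function. -/

theorem integrable_exp_neg_sq_div_two :
    MeasureTheory.Integrable fun t : ℝ => Real.exp (-t ^ 2 / 2) := by
  refine (integrable_exp_neg_mul_sq (b := 1 / 2) (by norm_num)).congr
    (Eventually.of_forall fun t => ?_)
  simp only
  congr 1
  ring

theorem integral_Ioi_exp_neg_sq_div_two :
    ∫ t in Set.Ioi (0 : ℝ), Real.exp (-t ^ 2 / 2) = √(2 * Real.pi) / 2 := by
  have h := integral_gaussian_Ioi (1 / 2)
  rw [show Real.pi / (1 / 2) = 2 * Real.pi by ring] at h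
  rw [← h]
  refine MeasureTheory.integral_congr_ae (Eventually.of_forall fun t => ?_)
  simp only
  congr 1
  ring

theorem gaussianQ_eq (y : ℝ) :
    gaussianQ y = 1 / 2 - 1 / √(2 * Real.pi) * ∫ t in (0 : ℝ)..y, Real.exp (-t ^ 2 / 2) := by
  have hi := integrable_exp_neg_sq_div_two
  have h := intervalIntegral.integral_interval_add_Ioi (a := 0) (b := y)
    (f := fun t : ℝ => Real.exp (-t ^ 2 / 2)) (μ := MeasureTheory.volume)
    hi.integrableOn hi.integrableOn
  rw [integral_Ioi_exp_neg_sq_div_two] at h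
  have hp : √(2 * Real.pi) ≠ 0 := (Real.sqrt_pos.2 (by positivity)).ne'
  rw [gaussianQ, eq_sub_of_add_eq' h]
  field_simp

theorem gaussianQ_zero : gaussianQ 0 = 1 / 2 := by
  simp [gaussianQ_eq]

theorem gaussianQ_neg (y : ℝ) : gaussianQ (-y) = 1 - gaussianQ y := by
  have h := intervalIntegral.integral_comp_neg (a := 0) (b := y)
    (fun t : ℝ => Real.exp (-t ^ 2 / 2))
  simp only [neg_sq, neg_zero] at h
  rw [gaussianQ_eq, gaussianQ_eq, intervalIntegral.integral_symm, ← h]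
  ring

theorem hasDerivAt_gaussianQ (y : ℝ) :
    HasDerivAt gaussianQ (-(1 / √(2 * Real.pi) * Real.exp (-y ^ 2 / 2))) y := by
  rw [show gaussianQ = fun y => 1 / 2 - 1 / √(2 * Real.pi) *
    ∫ t in (0 : ℝ)..y, Real.exp (-t ^ 2 / 2) from funext gaussianQ_eq]
  have hc : Continuous fun t : ℝ => Real.exp (-t ^ 2 / 2) := by fun_prop
  exact ((hc.integral_hasStrictDerivAt 0 y).hasDerivAt.const_mul _).const_sub _

theorem continuous_gaussianQ : Continuous gaussianQ :=
  continuous_iff_continuousAt.2 fun y => (hasDerivAt_gaussianQ y).continuousAt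

/-- Shift `t = u + y` and use `(u + y)² ≥ u² + y²` for `u, y ≥ 0`. -/
theorem two_mul_gaussianQ_le {y : ℝ} (hy : 0 ≤ y) :
    2 * gaussianQ y ≤ Real.exp (-y ^ 2 / 2) := by
  have hi := integrable_exp_neg_sq_div_two
  have h1 : ∫ t in Set.Ioi y, Real.exp (-t ^ 2 / 2) =
      ∫ u in Set.Ioi (0 : ℝ), Real.exp (-(u + y) ^ 2 / 2) := by
    have := (MeasureTheory.measurePreserving_add_right MeasureTheory.volume y).setIntegral_preimage_emb
      (measurableEmbedding_addRight y) (fun t : ℝ => Real.exp (-t ^ 2 / 2)) (Set.Ioi y)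
    rw [← this]
    simp
  have h2 : ∫ u in Set.Ioi (0 : ℝ), Real.exp (-(u + y) ^ 2 / 2) ≤
      ∫ u in Set.Ioi (0 : ℝ), Real.exp (-y ^ 2 / 2) * Real.exp (-u ^ 2 / 2) := by
    refine MeasureTheory.setIntegral_mono_on (hi.comp_add_right y).integrableOn
      (hi.const_mul _).integrableOn measurableSet_Ioi fun u hu => ?_
    rw [← Real.exp_add, Real.exp_le_exp]
    nlinarith [mul_nonneg (le_of_lt (Set.mem_Ioi.1 hu)) hy]
  rw [MeasureTheory.integral_const_mul, integral_Ioi_exp_neg_sq_div_two] at h2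
  have hp : 0 < √(2 * Real.pi) := Real.sqrt_pos.2 (by positivity)
  rw [gaussianQ, h1]
  calc _ ≤ 2 * (1 / √(2 * Real.pi) * (Real.exp (-y ^ 2 / 2) * (√(2 * Real.pi) / 2))) := by gcongr
    _ = _ := by field_simp

/-- Serves twice: it makes the numerator of `L` negative at `k = 1`, and it gives the disk-strip
inequality at `b = a`. -/
theorem two_mul_gaussianQ_lt_besselI {z : ℝ} (hz : 0 < z) :
    2 * gaussianQ (2 * √z) < Real.exp (-z) * besselI 0 z := by
  refine (two_mul_gaussianQ_le (by positivity)).trans_lt ?_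
  rw [mul_pow, Real.sq_sqrt hz.le]
  calc Real.exp (-(2 ^ 2 * z) / 2) < Real.exp (-z) := Real.exp_lt_exp.2 (by linarith)
    _ ≤ _ := le_mul_of_one_le_right (Real.exp_pos _).le (one_le_besselI_zero z)

theorem sqrt_two_mul_pi_mul_sqrt (x : ℝ) :
    √(2 * Real.pi) * √(2 * x) = 2 * √(Real.pi * x) := by
  rw [← Real.sqrt_mul (by positivity), show 2 * Real.pi * (2 * x) = 2 ^ 2 * (Real.pi * x) by ring,
    Real.sqrt_mul (by positivity), Real.sqrt_sq (by norm_num)]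

theorem hasDerivAt_gaussianQ_sqrt {c x : ℝ} (hc : 0 ≤ c) (hx : 0 < x) :
    HasDerivAt (fun x => gaussianQ (√(2 * x) * √c))
      (-(√c / (2 * √(Real.pi * x)) * Real.exp (-(c * x)))) x := by
  have h1 : HasDerivAt (fun x => √(2 * x) * √c) (2 / (2 * √(2 * x)) * √c) x := by
    have h0 : HasDerivAt (fun x : ℝ => 2 * x) 2 x := by
      simpa using (hasDerivAt_id x).const_mul 2
    exact (h0.sqrt (by positivity)).mul_const _
  refine ((hasDerivAt_gaussianQ _).comp x h1).congr_deriv ?_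
  rw [mul_pow, Real.sq_sqrt hc, Real.sq_sqrt (by positivity),
    show -(2 * x * c) / 2 = -(c * x) by ring, ← sqrt_two_mul_pi_mul_sqrt x]
  have hp : 0 < √(2 * Real.pi) := Real.sqrt_pos.2 (by positivity)
  have hq : 0 < √(2 * x) := Real.sqrt_pos.2 (by positivity)
  field_simp

/-! ### Upper bound for `I_1` by `sinh`. -/

/-- The function `sinh(zc) e^(-zc²/2)` is monotone in `c` on `[0,1]`, since `cosh(zc) ≥ c sinh(zc)`
there. -/
theorem sinh_mul_le {z c : ℝ} (hz : 0 ≤ z) (hc : c ∈ Set.Icc (0 : ℝ) 1) :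
    Real.sinh (z * c) ≤ Real.sinh z * Real.exp (-(z / 2) * (1 - c ^ 2)) := by
  have hd : ∀ c : ℝ, HasDerivAt (fun c => Real.sinh (z * c) * Real.exp (-(z / 2) * c ^ 2))
      (z * Real.exp (-(z / 2) * c ^ 2) * (Real.cosh (z * c) - c * Real.sinh (z * c))) c := by
    intro c
    have h1 : HasDerivAt (fun c : ℝ => z * c) z c := by
      simpa using (hasDerivAt_id c).const_mul z
    have h2 : HasDerivAt (fun c : ℝ => -(z / 2) * c ^ 2) (-(z * c)) c := by
      refine ((hasDerivAt_pow 2 c).const_mul (-(z / 2))).congr_deriv ?_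
      norm_num
      ring
    refine (h1.sinh.mul h2.exp).congr_deriv ?_
    ring
  have hm : MonotoneOn (fun c => Real.sinh (z * c) * Real.exp (-(z / 2) * c ^ 2))
      (Set.Icc 0 1) := by
    refine monotoneOn_of_deriv_nonneg (convex_Icc 0 1)
      (continuous_iff_continuousAt.2 fun c => (hd c).continuousAt).continuousOn
      (fun c _ => (hd c).differentiableAt.differentiableWithinAt) fun c hc => ?_
    rw [interior_Icc] at hc
    rw [(hd c).deriv]
    have h3 : 0 ≤ Real.sinh (z * c) := Real.sinh_nonneg_iff.2 (mul_nonneg hz hc.1.le)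
    have h4 := (Real.sinh_lt_cosh (z * c)).le
    have h5 : c * Real.sinh (z * c) ≤ Real.sinh (z * c) := mul_le_of_le_one_left h3 hc.2.le
    have : 0 ≤ Real.cosh (z * c) - c * Real.sinh (z * c) := by linarith
    positivity
  have h := hm hc (Set.right_mem_Icc.2 zero_le_one) hc.2
  simp only [mul_one, one_pow] at h
  have h6 : Real.exp (-(z / 2) * (1 - c ^ 2)) * Real.exp (-(z / 2) * c ^ 2) =
      Real.exp (-(z / 2)) := by
    rw [← Real.exp_add]; congr 1; ring
  rw [← h6, ← mul_assoc] at h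
  exact le_of_mul_le_mul_right h (Real.exp_pos _)

theorem besselI_one_lt_sinh {z : ℝ} (hz : 0 < z) :
    Real.pi * besselI 1 z < Real.sinh z * √(Real.pi / (z / 2)) := by
  have hs : 0 < Real.sinh z := Real.sinh_pos_iff.2 hz
  have h1 : Real.pi * besselI 1 z ≤ ∫ θ in (0 : ℝ)..Real.pi,
      Real.sinh z * (Real.exp (-(z / 2) * Real.cos θ ^ 2) * Real.sin θ) := by
    rw [besselI_one_eq_integral]
    refine intervalIntegral.integral_mono_on Real.pi_pos.le
      (Continuous.intervalIntegrable (by fun_prop) _ _)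
      (Continuous.intervalIntegrable (by fun_prop) _ _) fun θ hθ => ?_
    have h0 := Real.sin_nonneg_of_mem_Icc hθ
    have h2 := sinh_mul_le hz.le (c := Real.sin θ) ⟨h0, Real.sin_le_one θ⟩
    rw [← Real.cos_sq'] at h2
    rw [← mul_assoc]
    gcongr
  have h2 : ∫ θ in (0 : ℝ)..Real.pi, Real.exp (-(z / 2) * Real.cos θ ^ 2) * Real.sin θ =
      ∫ u in (-1 : ℝ)..1, Real.exp (-(z / 2) * u ^ 2) := by
    have := intervalIntegral.integral_comp_mul_deriv (a := 0) (b := Real.pi) (f := Real.cos)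
      (f' := fun θ => -Real.sin θ) (g := fun u => Real.exp (-(z / 2) * u ^ 2))
      (fun θ _ => Real.hasDerivAt_cos θ) (by fun_prop) (by fun_prop)
    rw [Real.cos_zero, Real.cos_pi, intervalIntegral.integral_symm (-1) 1] at this
    rw [← neg_inj, ← this, ← intervalIntegral.integral_neg]
    simp
  rw [intervalIntegral.integral_const_mul, h2] at h1
  refine h1.trans_lt ((mul_lt_mul_iff_right₀ hs).2 ?_)
  rw [← integral_gaussian]
  have hi := integrable_exp_neg_mul_sq (b := z / 2) (by positivity)
  have h3 := intervalIntegral.integral_interval_add_Ioi (a := (-1 : ℝ)) (b := 1)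
    hi.integrableOn hi.integrableOn
  have h4 := intervalIntegral.integral_Iic_add_Ioi (b := (-1 : ℝ))
    hi.integrableOn hi.integrableOn
  -- Extending `[-1,1]` to the whole line makes the inequality strict through the right tail.
  have h5 : 0 < ∫ u in Set.Ioi (1 : ℝ), Real.exp (-(z / 2) * u ^ 2) := by
    rw [MeasureTheory.setIntegral_pos_iff_support_of_nonneg_ae
      (Eventually.of_forall fun u => (Real.exp_pos _).le) hi.integrableOn]
    simp [Function.support, Real.exp_ne_zero]
  have h6 : 0 ≤ ∫ u in Set.Iic (-1 : ℝ), Real.exp (-(z / 2) * u ^ 2) :=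
    MeasureTheory.integral_nonneg fun u => (Real.exp_pos _).le
  linarith

theorem mul_besselI_one_lt {k x : ℝ} (hk : 0 < k) (hx : 0 < x) :
    k * besselI 1 (k * x) < √(2 * k) / √(Real.pi * x) * Real.sinh (k * x) := by
  have h := besselI_one_lt_sinh (mul_pos hk hx)
  have e : k / Real.pi * √(Real.pi / (k * x / 2)) = √(2 * k) / √(Real.pi * x) := by
    rw [← Real.sqrt_div (by positivity)]
    nth_rewrite 1 [← Real.sqrt_sq (by positivity : 0 ≤ k / Real.pi)]
    rw [← Real.sqrt_mul (by positivity)]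
    congr 1
    field_simp
  rw [← e]
  calc k * besselI 1 (k * x) = k / Real.pi * (Real.pi * besselI 1 (k * x)) := by
        field_simp
    _ < k / Real.pi * (Real.sinh (k * x) * √(Real.pi / (k * x / 2))) := by gcongr
    _ = _ := by ring

/-! ### The upper bound for `Ie`. -/

theorem hasDerivAt_exp_neg_mul_besselI (k x : ℝ) :
    HasDerivAt (fun x => Real.exp (-x) * besselI 0 (k * x))
      (Real.exp (-x) * (k * besselI 1 (k * x) - besselI 0 (k * x))) x := by
  have h1 : HasDerivAt (fun x : ℝ => k * x) k x := by
    simpa using (hasDerivAt_id x).const_mul k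
  refine ((hasDerivAt_neg x).exp.mul ((hasDerivAt_besselI_zero _).comp x h1)).congr_deriv ?_
  simp only [Function.comp]
  ring

theorem hasDerivAt_riceIe (k x : ℝ) :
    HasDerivAt (riceIe k) (Real.exp (-x) * besselI 0 (k * x)) x := by
  have hc : Continuous fun t => Real.exp (-t) * besselI 0 (k * t) := by
    have := continuous_besselI 0
    fun_prop
  exact (hc.integral_hasStrictDerivAt 0 x).hasDerivAt

theorem riceIe_zero_right (k : ℝ) : riceIe k 0 = 0 := by
  simp [riceIe]

/-- Comparison of `Ie(k,x)` with a function of `x` having the right derivative; it covers both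
`k < 1` and `k = 1`. -/
theorem riceIe_lt_of_hasDerivAt {k : ℝ} (hk : 0 < k) {M : ℝ → ℝ} (hM : Continuous M)
    (hM0 : M 0 = 0)
    (hM' : ∀ x, 0 < x →
      HasDerivAt M (√(2 * k) / (2 * √(Real.pi * x)) * Real.exp (-((1 - k) * x))) x)
    {x : ℝ} (hx : 0 < x) :
    riceIe k x < 1 - Real.exp (-x) * besselI 0 (k * x)
      - √(2 * k) / √(1 + k) * (1 / 2 - gaussianQ (√(2 * x) * √(1 + k))) + M x := by
  set D : ℝ → ℝ := fun x => 1 - Real.exp (-x) * besselI 0 (k * x)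
      - √(2 * k) / √(1 + k) * (1 / 2 - gaussianQ (√(2 * x) * √(1 + k))) + M x - riceIe k x with hD
  have hc : Continuous D := by
    have h1 := continuous_besselI 0
    have h2 := continuous_gaussianQ
    have h3 : Continuous (riceIe k) :=
      continuous_iff_continuousAt.2 fun x => (hasDerivAt_riceIe k x).continuousAt
    fun_prop
  have h1k : 0 < √(1 + k) := Real.sqrt_pos.2 (by linarith)
  have hd : ∀ x, 0 < x → HasDerivAt D (Real.exp (-x) *
      (√(2 * k) / √(Real.pi * x) * Real.sinh (k * x) - k * besselI 1 (k * x))) x := by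
    intro x hx
    have hpx : 0 < √(Real.pi * x) := Real.sqrt_pos.2 (by positivity)
    refine (((((hasDerivAt_exp_neg_mul_besselI k x).const_sub 1).sub
      (((hasDerivAt_gaussianQ_sqrt (c := 1 + k) (by linarith) hx).const_sub (1 / 2)).const_mul
        (√(2 * k) / √(1 + k)))).add (hM' x hx)).sub (hasDerivAt_riceIe k x)).congr_deriv ?_
    -- The terms in `e^(-x) I_0(kx)` cancel, and `e^(-(1-k)x) - e^(-(1+k)x) = 2 e^(-x) sinh(kx)`.
    rw [Real.sinh_eq, show -((1 + k) * x) = -x + -(k * x) by ring,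
      show -((1 - k) * x) = -x + k * x by ring, Real.exp_add, Real.exp_add]
    field_simp
    ring
  have hm : StrictMonoOn D (Set.Ici 0) := by
    refine strictMonoOn_of_deriv_pos (convex_Ici 0) hc.continuousOn fun y hy => ?_
    rw [interior_Ici] at hy
    rw [(hd y hy).deriv]
    exact mul_pos (Real.exp_pos _) (sub_pos.2 (mul_besselI_one_lt hk hy))
  have h0 : D 0 = 0 := by
    simp [hD, hM0, riceIe_zero_right, besselI_zero_zero, gaussianQ_zero]
  have h := hm (Set.self_mem_Ici) (Set.mem_Ici.2 hx.le) hx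
  rw [h0] at h
  exact sub_pos.1 h

/-- Each bracket `1/2 - Q` vanishes at `x = 0`, and the last one also absorbs the singular factor as
`k → 1`. -/
theorem riceUpper_eq (k x : ℝ) :
    riceUpper k x = 1 - Real.exp (-x) * besselI 0 (k * x)
      - √(2 * k) / √(1 + k) * (1 / 2 - gaussianQ (√(2 * x) * √(1 + k)))
      + √(2 * k) / √(1 - k) * (1 / 2 - gaussianQ (√(2 * x) * √(1 - k))) := by
  have h : ∀ c : ℝ, √k / √(2 * c) = √(2 * k) / √c * (1 / 2) := fun c => by
    rw [Real.sqrt_mul (by norm_num), Real.sqrt_mul (by norm_num)]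
    have h2' : √2 ≠ (0 : ℝ) := by positivity
    -- For `√c = 0` both sides are `0` by the convention for division by zero.
    rcases eq_or_ne √c 0 with hc | hc
    · simp [hc]
    field_simp
    rw [Real.sq_sqrt (by norm_num)]
  rw [riceUpper, h, h, Real.exp_neg]
  ring

theorem riceIe_lt_riceUpper {k x : ℝ} (hk : 0 < k) (hk1 : k < 1) (hx : 0 < x) :
    riceIe k x < riceUpper k x := by
  rw [riceUpper_eq]
  refine riceIe_lt_of_hasDerivAt hk
    (M := fun x => √(2 * k) / √(1 - k) * (1 / 2 - gaussianQ (√(2 * x) * √(1 - k)))) ?_ ?_ ?_ hx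
  · have h2 := continuous_gaussianQ
    fun_prop
  · simp [gaussianQ_zero]
  · intro x hx
    have h1k : 0 < √(1 - k) := Real.sqrt_pos.2 (by linarith)
    refine (((hasDerivAt_gaussianQ_sqrt (c := 1 - k) (by linarith) hx).const_sub
      (1 / 2)).const_mul _).congr_deriv ?_
    field_simp

/-- At `k = 1` the derivative required of `M` is `√2 / (2√(πx))`, whose primitive vanishing at `0`
is `√(2x/π)`. -/
theorem riceIe_one_lt {x : ℝ} (hx : 0 < x) :
    riceIe 1 x <
      1 / 2 + √(2 * x / Real.pi) + gaussianQ (2 * √x) - besselI 0 x / Real.exp x := by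
  have h := riceIe_lt_of_hasDerivAt one_pos (M := fun x => √(2 * x / Real.pi)) (by fun_prop)
    (by simp) (fun x hx => by
      have h1 : HasDerivAt (fun x : ℝ => 2 * x / Real.pi) (2 / Real.pi) x := by
        simpa using ((hasDerivAt_id x).const_mul 2).div_const Real.pi
      refine (h1.sqrt (by positivity)).congr_deriv ?_
      have h2 : √(2 * x / Real.pi) * √2 = 2 * √(Real.pi * x) / Real.pi := by
        rw [← Real.sqrt_mul (by positivity), eq_div_iff Real.pi_pos.ne']
        nth_rewrite 2 [← Real.sqrt_sq Real.pi_pos.le]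
        rw [← Real.sqrt_mul (by positivity),
          show 2 * x / Real.pi * 2 * Real.pi ^ 2 = 2 ^ 2 * (Real.pi * x) by field_simp,
          Real.sqrt_mul (by positivity), Real.sqrt_sq (by norm_num)]
      have h3 : 0 < √(2 * x / Real.pi) := Real.sqrt_pos.2 (by positivity)
      have h4 : 0 < √(Real.pi * x) := Real.sqrt_pos.2 (by positivity)
      rw [eq_div_iff Real.pi_pos.ne'] at h2
      rw [mul_one, sub_self, zero_mul, neg_zero, Real.exp_zero, mul_one,
        div_eq_div_iff (by positivity) (by positivity)]
      field_simp
      linarith) hx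
  have e : √(2 * x) * √(1 + 1) = 2 * √x := by
    rw [← Real.sqrt_mul (by positivity), show 2 * x * (1 + 1) = 2 ^ 2 * x by ring,
      Real.sqrt_mul (by positivity), Real.sqrt_sq (by norm_num)]
  have e2 : √(2 * 1) / √(1 + 1) = (1 : ℝ) := by norm_num
  rw [e, e2, one_mul, one_mul, Real.exp_neg] at h
  refine h.trans_eq ?_
  ring

/-! ### Limits for `k → 1⁻` and the case `k = 0`. -/

/-- With `e = √(1-k)`, the singular term is `-√(2k)` times the slope at `0` of `e ↦ Q(√(2x) e)`, so
its limit comes from the derivative of `Q`. -/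
theorem tendsto_riceUpper (x : ℝ) :
    Tendsto (fun k : ℝ => riceUpper k x) (𝓝[<] 1)
      (𝓝 (1 / 2 + √(2 * x / Real.pi) + gaussianQ (2 * √x) - besselI 0 x / Real.exp x)) := by
  have hQ := continuous_gaussianQ
  have hB := continuous_besselI 0
  have h1 : HasDerivAt (fun e => gaussianQ (√(2 * x) * e)) (-(√(2 * x) / √(2 * Real.pi))) 0 := by
    have h0 : HasDerivAt (fun e : ℝ => √(2 * x) * e) (√(2 * x)) 0 := by
      simpa using (hasDerivAt_id (0 : ℝ)).const_mul √(2 * x)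
    refine ((hasDerivAt_gaussianQ _).comp (0 : ℝ) h0).congr_deriv ?_
    simp
    ring
  have h2 := h1.tendsto_slope
  have h3 : Tendsto (fun k : ℝ => √(1 - k)) (𝓝[<] 1) (𝓝[≠] 0) := by
    refine tendsto_nhdsWithin_iff.2 ⟨?_, ?_⟩
    · have : Continuous fun k : ℝ => √(1 - k) := by fun_prop
      simpa using (this.tendsto 1).mono_left nhdsWithin_le_nhds
    · filter_upwards [self_mem_nhdsWithin] with k hk
      exact (Real.sqrt_pos.2 (sub_pos.2 hk)).ne'
  have h4 := h2.comp h3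
  have h5 : ContinuousAt (fun k : ℝ => 1 - Real.exp (-x) * besselI 0 (k * x)
      - √(2 * k) / √(1 + k) * (1 / 2 - gaussianQ (√(2 * x) * √(1 + k)))) 1 := by
    have : √(1 + 1 : ℝ) ≠ 0 := by positivity
    fun_prop (disch := exact this)
  have h6 : Continuous fun k : ℝ => √(2 * k) := by fun_prop
  have h7 := (h5.tendsto.mono_left (nhdsWithin_le_nhds (s := Set.Iio 1))).sub
    (((h6.tendsto 1).mono_left (nhdsWithin_le_nhds (s := Set.Iio 1))).mul h4)
  have e : √(2 * x) * √(1 + 1) = 2 * √x := by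
    rw [mul_comm 2 x, Real.sqrt_mul' _ (by norm_num), mul_assoc, show (1 + 1 : ℝ) = 2 by norm_num,
      Real.mul_self_sqrt (by norm_num), mul_comm]
  have e2 : √(2 * 1) / √(1 + 1) = (1 : ℝ) := by norm_num
  have e3 : √(2 * 1) * (√(2 * x) / √(2 * Real.pi)) = √(2 * x / Real.pi) := by
    rw [mul_one, Real.sqrt_mul (by norm_num) Real.pi, Real.sqrt_div' _ Real.pi_pos.le]
    have : √2 ≠ (0 : ℝ) := by positivity
    have : √Real.pi ≠ 0 := (Real.sqrt_pos.2 Real.pi_pos).ne'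
    field_simp
  rw [e, e2, mul_neg, e3] at h7
  refine Tendsto.congr (fun k => ?_) (h7.trans_eq ?_)
  · rw [riceUpper_eq]
    simp only [Function.comp, slope_def_field, mul_zero, gaussianQ_zero, sub_zero]
    ring
  · congr 1
    rw [Real.exp_neg, one_mul x]
    ring

theorem sqrt_mul_sqrt_one_add_sub {k x s : ℝ} (hx : 0 ≤ x) (hs0 : 0 ≤ s)
    (hs : s ^ 2 = 1 - k ^ 2) (hk : 0 ≤ k) :
    √x * √(1 + s) * (√x * √(1 - s)) = k * x := by
  have h : √(1 + s) * √(1 - s) = k := by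
    rw [← Real.sqrt_mul (by linarith), show (1 + s) * (1 - s) = k ^ 2 by linarith,
      Real.sqrt_sq hk]
  calc _ = (√x * √x) * (√(1 + s) * √(1 - s)) := by ring
    _ = _ := by rw [h, Real.mul_self_sqrt hx]; ring

theorem riceLower_zero (x : ℝ) : riceLower 0 x = riceIe 0 x := by
  have h : riceIe 0 x = 1 - Real.exp (-x) := by
    simp [riceIe, besselI_zero_zero]
  rw [h]
  simp only [riceLower, riceA, riceB]
  -- Here `b = 0`, and `Q(a) + Q(-a) = 1`.
  norm_num [besselI_zero_zero, gaussianQ_neg]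
  ring

theorem riceUpper_zero (x : ℝ) : riceUpper 0 x = riceIe 0 x := by
  have h : riceIe 0 x = 1 - Real.exp (-x) := by
    simp [riceIe, besselI_zero_zero]
  rw [h, riceUpper_eq]
  simp [besselI_zero_zero]

/-- At `k = 1` one has `a = b = √x`, so the numerator tends to `2Q(2√x) - e^(-x) I_0(x) < 0` while
the denominator tends to `0⁺`. -/
theorem tendsto_riceLower {x : ℝ} (hx : 0 < x) :
    Tendsto (fun k : ℝ => riceLower k x) (𝓝[<] 1) atBot := by
  have hQ := continuous_gaussianQ
  have hB := continuous_besselI 0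
  have h1 : Continuous fun k : ℝ => 2 * gaussianQ (riceB k x + riceA k x)
      + 2 * gaussianQ (riceB k x - riceA k x) - Real.exp (-x) * besselI 0 (k * x) - 1 := by
    unfold riceA riceB
    fun_prop
  have h2 := (h1.tendsto 1).mono_left (nhdsWithin_le_nhds (s := Set.Iio 1))
  have h3 : Tendsto (fun k : ℝ => √(1 - k ^ 2)) (𝓝[<] 1) (𝓝[>] 0) := by
    refine tendsto_nhdsWithin_iff.2 ⟨?_, ?_⟩
    · have : Continuous fun k : ℝ => √(1 - k ^ 2) := by fun_prop
      simpa using (this.tendsto 1).mono_left nhdsWithin_le_nhds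
    · filter_upwards [Ioo_mem_nhdsLT (show (-1 : ℝ) < 1 by norm_num)] with k hk
      exact Real.sqrt_pos.2 (by nlinarith [hk.1, hk.2])
  have h4 := h3.inv_tendsto_nhdsGT_zero
  simp only [riceLower, div_eq_mul_inv]
  refine h2.neg_mul_atTop ?_ h4
  have h5 := two_mul_gaussianQ_lt_besselI hx
  have h6 : √x + √x = 2 * √x := by ring
  simp [riceA, riceB, gaussianQ_zero, h6]
  linarith

/-! ### Monotonicity of `z I_0(z) / cosh z`. -/

/-- The function `z ↦ z I_0(z) / cosh z` has positive derivative for `z > 0`. -/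
theorem besselI_cosh_pos {z : ℝ} (hz : 0 ≤ z) :
    0 < besselI 0 z * Real.cosh z +
      z * (besselI 1 z * Real.cosh z - besselI 0 z * Real.sinh z) := by
  set W : ℝ → ℝ := fun z => besselI 0 z * Real.cosh z +
      z * (besselI 1 z * Real.cosh z - besselI 0 z * Real.sinh z) with hW
  -- All other terms cancel because `(z I_1)' = z I_0`.
  have hd : ∀ z, HasDerivAt W (besselI 1 z * Real.cosh z) z := fun z => by
    refine (((hasDerivAt_besselI_zero z).mul (Real.hasDerivAt_cosh z)).add
      ((hasDerivAt_id z).mul (((hasDerivAt_besselI_one z).mul (Real.hasDerivAt_cosh z)).sub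
        ((hasDerivAt_besselI_zero z).mul (Real.hasDerivAt_sinh z))))).congr_deriv ?_
    rw [besselI_one_eq]
    simp only [id, Pi.mul_apply, Pi.sub_apply, besselI_one_eq]
    ring
  have hm : MonotoneOn W (Set.Ici 0) := by
    refine monotoneOn_of_deriv_nonneg (convex_Ici 0)
      (continuous_iff_continuousAt.2 fun c => (hd c).continuousAt).continuousOn
      (fun c _ => (hd c).differentiableAt.differentiableWithinAt) fun c hc => ?_
    rw [interior_Ici] at hc
    rw [(hd c).deriv]
    exact (mul_pos (besselI_one_pos hc) (Real.cosh_pos c)).le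
  have h := hm Set.self_mem_Ici (Set.mem_Ici.2 hz) hz
  have h0 : W 0 = 1 := by simp [hW, besselI_zero_zero]
  rw [h0] at h
  exact one_pos.trans_le h

theorem strictMonoOn_besselI_div_cosh {a : ℝ} (ha : 0 ≤ a) :
    StrictMonoOn (fun y => y * besselI 0 (a * y) / Real.cosh (a * y)) (Set.Ici 0) := by
  have hd : ∀ y, HasDerivAt (fun y => y * besselI 0 (a * y) / Real.cosh (a * y))
      ((besselI 0 (a * y) * Real.cosh (a * y) + a * y * (besselI 1 (a * y) * Real.cosh (a * y)
        - besselI 0 (a * y) * Real.sinh (a * y))) / Real.cosh (a * y) ^ 2) y := fun y => by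
    have h1 : HasDerivAt (fun y : ℝ => a * y) a y := by
      simpa using (hasDerivAt_id y).const_mul a
    refine (((hasDerivAt_id y).mul ((hasDerivAt_besselI_zero _).comp y h1)).div h1.cosh
      (Real.cosh_pos _).ne').congr_deriv ?_
    simp only [id, Function.comp, Pi.mul_apply]
    ring
  refine strictMonoOn_of_deriv_pos (convex_Ici 0)
    (continuous_iff_continuousAt.2 fun c => (hd c).continuousAt).continuousOn fun y hy => ?_
  rw [interior_Ici] at hy
  rw [(hd y).deriv]
  exact div_pos (besselI_cosh_pos (mul_nonneg ha (le_of_lt hy))) (pow_pos (Real.cosh_pos _) 2)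

/-! ### The Gaussian disk probability and the Rice function. -/

/-- The probability that a planar standard Gaussian vector lies in a disk of radius `b` whose
centre has distance `a` from the origin. -/
noncomputable def gaussianDisk (a b : ℝ) : ℝ :=
  ∫ ρ in (0 : ℝ)..b, ρ * Real.exp (-((a ^ 2 + ρ ^ 2) / 2)) * besselI 0 (a * ρ)

theorem hasDerivAt_gaussianDisk (a b : ℝ) :
    HasDerivAt (gaussianDisk a) (b * Real.exp (-((a ^ 2 + b ^ 2) / 2)) * besselI 0 (a * b)) b := by
  have hc : Continuous fun ρ => ρ * Real.exp (-((a ^ 2 + ρ ^ 2) / 2)) * besselI 0 (a * ρ) := by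
    have := continuous_besselI 0
    fun_prop
  exact (hc.integral_hasStrictDerivAt 0 b).hasDerivAt

/-- The common value of `∂ₜ [t ρ e^(-t(a²+ρ²)/2) I_0(taρ)]` and
`∂ᵨ [e^(-t(a²+ρ²)/2) (ρ² I_0(taρ) - aρ I_1(taρ)) / 2]`. -/
noncomputable def diskFlow (a ρ t : ℝ) : ℝ :=
  Real.exp (-(t * ((a ^ 2 + ρ ^ 2) / 2))) * (ρ * besselI 0 (t * a * ρ)
    - t * ρ * ((a ^ 2 + ρ ^ 2) / 2) * besselI 0 (t * a * ρ)
    + t * a * ρ ^ 2 * besselI 1 (t * a * ρ))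

theorem hasDerivAt_diskFlow_time (a ρ t : ℝ) :
    HasDerivAt (fun t => t * ρ * Real.exp (-(t * ((a ^ 2 + ρ ^ 2) / 2))) * besselI 0 (t * a * ρ))
      (diskFlow a ρ t) t := by
  have h1 : HasDerivAt (fun t : ℝ => t * a * ρ) (a * ρ) t := by
    simpa using ((hasDerivAt_id t).mul_const a).mul_const ρ
  have h2 : HasDerivAt (fun t : ℝ => t * ρ) ρ t := by
    simpa using (hasDerivAt_id t).mul_const ρ
  have h3 : HasDerivAt (fun t : ℝ => -(t * ((a ^ 2 + ρ ^ 2) / 2))) (-((a ^ 2 + ρ ^ 2) / 2)) t := by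
    refine ((hasDerivAt_id t).mul_const ((a ^ 2 + ρ ^ 2) / 2)).neg.congr_deriv ?_
    rw [one_mul]
  refine ((h2.mul h3.exp).mul ((hasDerivAt_besselI_zero _).comp t h1)).congr_deriv ?_
  simp only [Function.comp, Pi.mul_apply, diskFlow]
  ring

theorem hasDerivAt_diskFlow_radius (a ρ t : ℝ) :
    HasDerivAt (fun ρ => Real.exp (-(t * ((a ^ 2 + ρ ^ 2) / 2))) *
      (ρ ^ 2 * besselI 0 (t * a * ρ) - a * ρ * besselI 1 (t * a * ρ)) / 2)
      (diskFlow a ρ t) ρ := by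
  have h1 : HasDerivAt (fun ρ : ℝ => t * a * ρ) (t * a) ρ := by
    simpa using (hasDerivAt_id ρ).const_mul (t * a)
  have h2 : HasDerivAt (fun ρ : ℝ => a * ρ) a ρ := by
    simpa using (hasDerivAt_id ρ).const_mul a
  have h4 : HasDerivAt (fun ρ : ℝ => ρ ^ 2) (2 * ρ) ρ := by
    simpa using hasDerivAt_pow 2 ρ
  have h3 : HasDerivAt (fun ρ : ℝ => -(t * ((a ^ 2 + ρ ^ 2) / 2))) (-(t * ρ)) ρ := by
    refine ((((h4.const_add (a ^ 2)).div_const 2).const_mul t).neg).congr_deriv ?_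
    ring
  refine ((h3.exp.mul ((h4.mul ((hasDerivAt_besselI_zero _).comp ρ h1)).sub
    (h2.mul ((hasDerivAt_besselI_one _).comp ρ h1)))).div_const 2).congr_deriv ?_
  simp only [Function.comp, Pi.mul_apply, Pi.sub_apply, diskFlow]
  simp only [besselI_one_eq]
  ring

/-- Scaling `a` and `b` by `√t` gives a disk probability that is `0` at `t = 0`. Its `t`-derivative
is a boundary term by `diskFlow`, and Fubini on a rectangle exchanges the two integrations. -/
theorem gaussianDisk_eq_integral (a b : ℝ) :
    gaussianDisk a b = ∫ t in (0 : ℝ)..1, Real.exp (-(t * ((a ^ 2 + b ^ 2) / 2))) *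
      (b ^ 2 * besselI 0 (t * a * b) - a * b * besselI 1 (t * a * b)) / 2 := by
  have hc : Continuous fun p : ℝ × ℝ => diskFlow a p.1 p.2 := by
    have h0 := continuous_besselI 0
    have h1 := continuous_besselI 1
    unfold diskFlow
    fun_prop
  have hc1 : ∀ ρ, Continuous fun t => diskFlow a ρ t := fun ρ =>
    hc.comp (by fun_prop : Continuous fun t : ℝ => (ρ, t))
  have hc2 : ∀ t, Continuous fun ρ => diskFlow a ρ t := fun t =>
    hc.comp (by fun_prop : Continuous fun ρ : ℝ => (ρ, t))
  have e1 : ∀ ρ, ∫ t in (0 : ℝ)..1, diskFlow a ρ t =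
      ρ * Real.exp (-((a ^ 2 + ρ ^ 2) / 2)) * besselI 0 (a * ρ) := fun ρ => by
    rw [intervalIntegral.integral_eq_sub_of_hasDerivAt
      (fun t _ => hasDerivAt_diskFlow_time a ρ t) ((hc1 ρ).intervalIntegrable _ _)]
    simp
  have e2 : ∀ t, ∫ ρ in (0 : ℝ)..b, diskFlow a ρ t =
      Real.exp (-(t * ((a ^ 2 + b ^ 2) / 2))) *
      (b ^ 2 * besselI 0 (t * a * b) - a * b * besselI 1 (t * a * b)) / 2 := fun t => by
    rw [intervalIntegral.integral_eq_sub_of_hasDerivAt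
      (fun ρ _ => hasDerivAt_diskFlow_radius a ρ t) ((hc2 t).intervalIntegrable _ _)]
    simp
  simp_rw [gaussianDisk, ← e1, ← e2]
  refine MeasureTheory.intervalIntegral_intervalIntegral_swap
    (MeasureTheory.IntegrableOn.mono_set ?_
      (Set.prod_mono Set.uIoc_subset_uIcc Set.uIoc_subset_uIcc))
  exact hc.continuousOn.integrableOn_compact (isCompact_uIcc.prod isCompact_uIcc)

/-- The disk probability in terms of the Rice function. -/
theorem two_mul_gaussianDisk {a b k x : ℝ} (hx : 0 < x) (h : a ^ 2 + b ^ 2 = 2 * x)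
    (hab : a * b = k * x) :
    2 * gaussianDisk a b =
      1 - Real.exp (-x) * besselI 0 (k * x) - (1 - b ^ 2 / x) * riceIe k x := by
  have hB0 := continuous_besselI 0
  have hB1 := continuous_besselI 1
  have h1 : ∫ u in (0 : ℝ)..x, Real.exp (-u) * (k * besselI 1 (k * u) - besselI 0 (k * u)) =
      Real.exp (-x) * besselI 0 (k * x) - 1 := by
    rw [intervalIntegral.integral_eq_sub_of_hasDerivAt
      (fun u _ => hasDerivAt_exp_neg_mul_besselI k u)
      (Continuous.intervalIntegrable (by fun_prop) _ _)]
    simp [besselI_zero_zero]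
  -- After `u = tx` the integrand splits into a multiple of the Rice integrand and an exact
  -- derivative.
  set f : ℝ → ℝ := fun u => (b ^ 2 - x) / 2 * (Real.exp (-u) * besselI 0 (k * u)) -
    x / 2 * (Real.exp (-u) * (k * besselI 1 (k * u) - besselI 0 (k * u))) with hf
  have h2 : gaussianDisk a b = ∫ t in (0 : ℝ)..1, f (t * x) := by
    rw [gaussianDisk_eq_integral]
    refine intervalIntegral.integral_congr fun t _ => ?_
    simp only [hf]
    rw [show (a ^ 2 + b ^ 2) / 2 = x by linarith, mul_assoc t a b, hab,
      show t * (k * x) = k * (t * x) by ring]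
    ring
  rw [intervalIntegral.integral_comp_mul_right f hx.ne', hf, zero_mul, one_mul,
    intervalIntegral.integral_sub (Continuous.intervalIntegrable (by fun_prop) _ _)
      (Continuous.intervalIntegrable (by fun_prop) _ _),
    intervalIntegral.integral_const_mul, intervalIntegral.integral_const_mul, h1, smul_eq_mul,
    show ∫ u in (0 : ℝ)..x, Real.exp (-u) * besselI 0 (k * u) = riceIe k x from rfl] at h2
  rw [h2]
  field_simp
  ring

/-! ### Disk against strip, and the lower bound. -/

/-- As a function of the radius, strip minus disk has a derivative with the sign of `2/√(2π) - r`,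
where `r` is increasing. It therefore rises and may then fall. Since it is `0` at radius `0` and
positive at radius `a`, it is positive between. -/
theorem gaussianDisk_lt_strip {a b : ℝ} (ha : 0 < a) (hb : 0 < b) (hba : b < a) :
    gaussianDisk a b < gaussianQ (a - b) - gaussianQ (a + b) := by
  set T : ℝ → ℝ := fun y => gaussianQ (a - y) - gaussianQ (a + y) - gaussianDisk a y with hT
  set r : ℝ → ℝ := fun y => y * besselI 0 (a * y) / Real.cosh (a * y) with hr
  have hrm : StrictMonoOn r (Set.Ici 0) := strictMonoOn_besselI_div_cosh ha.le
  have hd : ∀ y, HasDerivAt T (Real.exp (-((a ^ 2 + y ^ 2) / 2)) * Real.cosh (a * y) *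
      (2 / √(2 * Real.pi) - r y)) y := fun y => by
    have h1 : HasDerivAt (fun y : ℝ => a - y) (-1) y := (hasDerivAt_id y).const_sub a
    have h2 : HasDerivAt (fun y : ℝ => a + y) 1 y := (hasDerivAt_id y).const_add a
    refine ((((hasDerivAt_gaussianQ _).comp y h1).sub ((hasDerivAt_gaussianQ _).comp y h2)).sub
      (hasDerivAt_gaussianDisk a y)).congr_deriv ?_
    have hcosh := (Real.cosh_pos (a * y)).ne'
    have e : Real.exp (-((a ^ 2 + y ^ 2) / 2)) * Real.cosh (a * y) * r y =
        y * Real.exp (-((a ^ 2 + y ^ 2) / 2)) * besselI 0 (a * y) := by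
      simp only [hr]
      field_simp
    rw [mul_sub, e, Real.cosh_eq,
      show -(a - y) ^ 2 / 2 = -((a ^ 2 + y ^ 2) / 2) + a * y by ring,
      show -(a + y) ^ 2 / 2 = -((a ^ 2 + y ^ 2) / 2) + -(a * y) by ring, Real.exp_add,
      Real.exp_add]
    ring
  have hTc : Continuous T := continuous_iff_continuousAt.2 fun y => (hd y).continuousAt
  have hpos : ∀ y, 0 < Real.exp (-((a ^ 2 + y ^ 2) / 2)) * Real.cosh (a * y) := fun y =>
    mul_pos (Real.exp_pos _) (Real.cosh_pos _)
  have hT0 : T 0 = 0 := by simp [hT, gaussianDisk]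
  have hTa : 0 < T a := by
    -- For `b = a` the coefficient `1 - b²/x` of the Rice function is zero.
    have h1 := two_mul_gaussianDisk (a := a) (b := a) (k := 1) (x := a ^ 2) (by positivity)
      (by ring) (by ring)
    have h2 := two_mul_gaussianQ_lt_besselI (z := a ^ 2) (by positivity)
    rw [div_self (by positivity), sub_self, zero_mul, one_mul] at h1
    rw [Real.sqrt_sq ha.le] at h2
    simp only [hT, sub_self, gaussianQ_zero, ← two_mul]
    linarith
  suffices 0 < T b from sub_pos.1 this
  rcases le_or_gt (r b) (2 / √(2 * Real.pi)) with h | h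
  · have hm : StrictMonoOn T (Set.Icc 0 b) := by
      refine strictMonoOn_of_deriv_pos (convex_Icc 0 b) hTc.continuousOn fun y hy => ?_
      rw [interior_Icc] at hy
      rw [(hd y).deriv]
      have := hrm (Set.mem_Ici.2 hy.1.le) (Set.mem_Ici.2 hb.le) hy.2
      exact mul_pos (hpos y) (by linarith)
    rw [← hT0]
    exact hm (Set.left_mem_Icc.2 hb.le) (Set.right_mem_Icc.2 hb.le) hb
  · have hm : StrictAntiOn T (Set.Icc b a) := by
      refine strictAntiOn_of_deriv_neg (convex_Icc b a) hTc.continuousOn fun y hy => ?_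
      rw [interior_Icc] at hy
      rw [(hd y).deriv]
      have := hrm (Set.mem_Ici.2 hb.le) (Set.mem_Ici.2 (hb.trans hy.1).le) hy.1
      exact mul_neg_of_pos_of_neg (hpos y) (by linarith)
    exact hTa.trans (hm (Set.left_mem_Icc.2 hba.le) (Set.right_mem_Icc.2 hba.le) hba)

theorem riceLower_lt_riceIe {k x : ℝ} (hk : 0 < k) (hk1 : k < 1) (hx : 0 < x) :
    riceLower k x < riceIe k x := by
  have hk2 : 0 < 1 - k ^ 2 := by nlinarith
  set s := √(1 - k ^ 2) with hs
  have hs0 : 0 < s := Real.sqrt_pos.2 hk2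
  have hs2 : s ^ 2 = 1 - k ^ 2 := Real.sq_sqrt hk2.le
  have hs1 : s < 1 := by nlinarith
  have hb : 0 < riceB k x := mul_pos (Real.sqrt_pos.2 hx) (Real.sqrt_pos.2 (by linarith))
  have ha : 0 < riceA k x := mul_pos (Real.sqrt_pos.2 hx) (Real.sqrt_pos.2 (by linarith))
  have hba : riceB k x < riceA k x :=
    mul_lt_mul_of_pos_left (Real.sqrt_lt_sqrt (by linarith) (by linarith)) (Real.sqrt_pos.2 hx)
  have ha2 : riceA k x ^ 2 = x * (1 + s) := by
    rw [riceA, mul_pow, Real.sq_sqrt hx.le, Real.sq_sqrt (by linarith)]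
  have hb2 : riceB k x ^ 2 = x * (1 - s) := by
    rw [riceB, mul_pow, Real.sq_sqrt hx.le, Real.sq_sqrt (by linarith)]
  have hab : riceA k x * riceB k x = k * x :=
    sqrt_mul_sqrt_one_add_sub hx.le hs0.le hs2 hk.le
  have h1 := two_mul_gaussianDisk hx (by rw [ha2, hb2]; ring) hab
  have h2 := gaussianDisk_lt_strip ha hb hba
  -- Since `b² = x(1-s)`, the coefficient `1 - b²/x` equals `s`.
  rw [hb2, mul_div_cancel_left₀ _ hx.ne', sub_sub_cancel] at h1
  rw [riceLower, ← hs, div_lt_iff₀ hs0, ← neg_sub (riceA k x), gaussianQ_neg,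
    add_comm (riceB k x)]
  linarith

/-- Bounds for the Rice function for `x > 0` and `0 ≤ k ≤ 1`. Both strict inequalities hold for
`0 < k < 1`. At `k = 0` both bounds are attained. At `k = 1`, where both formulas contain a
division by zero, they are read as their limits for `k → 1⁻`, which are a finite number for the
upper bound and `-∞` for the lower bound. -/
theorem theorem5 (x : ℝ) (hx : 0 < x) :
    (∀ k : ℝ, 0 < k → k < 1 → riceLower k x < riceIe k x ∧ riceIe k x < riceUpper k x) ∧
    (riceLower 0 x = riceIe 0 x ∧ riceIe 0 x = riceUpper 0 x) ∧
    (Tendsto (fun k : ℝ => riceLower k x) (𝓝[<] 1) atBot ∧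
      Tendsto (fun k : ℝ => riceUpper k x) (𝓝[<] 1)
        (𝓝 (1 / 2 + √(2 * x / Real.pi) + gaussianQ (2 * √x) - besselI 0 x / Real.exp x)) ∧
      riceIe 1 x <
        1 / 2 + √(2 * x / Real.pi) + gaussianQ (2 * √x) - besselI 0 x / Real.exp x) := by
  exact ⟨fun k hk hk1 => ⟨riceLower_lt_riceIe hk hk1 hx, riceIe_lt_riceUpper hk hk1 hx⟩,
    ⟨riceLower_zero x, (riceUpper_zero x).symm⟩,
    tendsto_riceLower hx, tendsto_riceUpper x, riceIe_one_lt hx⟩
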